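/- Let $\mathcal{H}$ be a separable complex Hilbert space (of finite or countably infinite dimension) with unit sphere $\mathbb{S}(\mathcal{H})$, equipped with its Borel $\sigma$-algebra, and let $\rho$ be a density matrix on $\mathcal{H}$, i.e. a positive operator with $\mathrm{tr}\,\rho=1$. Let $(|n\rangle)_n$ be an orthonormal basis of eigenvectors of $\rho$ with eigenvalues $p_n$, let $Z_n$ be independent centered complex Gaussian random variables with $\mathbb{E}|Z_n|^2=p_n$ (real and imaginary parts independent, each of variance $p_n/2$), and let $\mathrm{G}(\rho)$ be the distribution of $\sum_n Z_n|n\rangle$ on $\mathcal{H}$. Let $\mathrm{GA}(\rho)(d\psi)=\|\psi\|^2\,\mathrm{G}(\rho)(d\psi)$, and let $\mathrm{GAP}(\rho)$ be the distribution on $\mathbb{S}(\mathcal{H})$ of $\Psi/\|\Psi\|$, where $\Psi$ has distribution $\mathrm{GA}(\rho)$; the probability measure $\mathrm{GAP}(\rho)$ does not depend on the choice of the eigenbasis. Then for every bounded operator $B$ on $\mathcal{H}$, the operator $\rho B$ has a well-defined trace (the series of its diagonal matrix elements converges to the same value in every orthonormal basis), and for every $\varepsilon\geq 0$, $$\mathrm{GAP}(\rho)\Bigl\{\psi\in\mathbb{S}(\mathcal{H}):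 \bigl|\langle\psi|B|\psi\rangle-\mathrm{tr}(\rho B)\bigr|>\varepsilon\Bigr\}\leq 12\exp\left(-\frac{\tilde C\,\varepsilon^2}{\|B\|^2\,\|\rho\|}\right),\qquad \tilde C=\frac{1}{2304\pi^2},$$ where $\|\cdot\|$ is the operator norm (for $B=0$ the exponential is read as $1$). -/

import Mathlib

open scoped InnerProductSpace NNReal ENNReal
open MeasureTheory ProbabilityTheory

universe u

namespace GapMeasure

section Operators

variable {H : Type u} [NormedAddCommGroup H] [InnerProductSpace ℂ H]

/-- `T` has trace `t`: the series of diagonal matrix elements of `T` converges (unconditionally) to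
`t` in every orthonormal basis of `H`. -/
def HasTrace (T : H →L[ℂ] H) (t : ℂ) : Prop :=
  ∀ (ι : Type u) (e : HilbertBasis ι ℂ H), HasSum (fun i => ⟪e i, T (e i)⟫_ℂ) t

/-- A density matrix: a positive operator with trace one. -/
structure IsDensityMatrix (ρ : H →L[ℂ] H) : Prop where
  isPositive : ρ.IsPositive
  hasTrace_one : HasTrace ρ 1

/-- An orthonormal basis of eigenvectors of `ρ`, with nonnegative eigenvalues. -/
structure EigenONB (ρ : H →L[ℂ] H) where
  index : Type u
  basis : HilbertBasis index ℂ H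
  eigenvalue : index → ℝ≥0
  apply_basis : ∀ i, ρ (basis i) = ((eigenvalue i : ℝ) : ℂ) • basis i

variable [CompleteSpace H]

/-- The trace of `T`, computed in some orthonormal basis of `H`. Whenever `HasTrace T t` holds, it is
equal to `t` (`HasTrace.trace_eq`). -/
noncomputable def trace (T : H →L[ℂ] H) : ℂ :=
  ∑' i, ⟪(exists_hilbertBasis ℂ H).choose_spec.choose i,
    T ((exists_hilbertBasis ℂ H).choose_spec.choose i)⟫_ℂ

theorem HasTrace.trace_eq {T : H →L[ℂ] H} {t : ℂ} (h : HasTrace T t) : trace T = t :=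
  (h _ _).tsum_eq

theorem isCompactOperator_of_summable_norm_sq {ι : Type u} (e : HilbertBasis ι ℂ H)
    (T : H →L[ℂ] H) (hT : T.IsPositive) (hs : Summable (fun i => ‖T (e i)‖ ^ 2)) :
    IsCompactOperator T := by
  classical
  let F : Finset ι → (H →L[ℂ] H) := fun s => ∑ i ∈ s, (innerSL ℂ (T (e i))).smulRight (e i)
  have hF : ∀ s, IsCompactOperator (F s) := by
    intro s
    have : F s ∈ compactOperator (RingHom.id ℂ) H H := by
      refine Submodule.sum_mem _ fun i _ => ?_
      have h1 : IsCompactOperator (innerSL ℂ (T (e i))) :=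
        isCompactOperator_of_locallyCompactSpace_dom _
      have := h1.clm_comp (ContinuousLinearMap.toSpanSingleton ℂ (e i))
      exact this
    exact this
  refine isCompactOperator_of_tendsto (l := Filter.atTop) (F := F) ?_
    (Filter.Eventually.of_forall hF)
  have key : ∀ s, ‖F s - T‖ ≤ √((∑' i, ‖T (e i)‖ ^ 2) - ∑ i ∈ s, ‖T (e i)‖ ^ 2) := by
    intro s
    refine ContinuousLinearMap.opNorm_le_bound _ (Real.sqrt_nonneg _) fun x => ?_
    have hc : ∀ i, ⟪e i, (F s - T) x⟫_ℂ = if i ∈ s then 0 else -⟪T (e i), x⟫_ℂ := by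
      intro i
      have h1 : ⟪e i, T x⟫_ℂ = ⟪T (e i), x⟫_ℂ := (hT.inner_left_eq_inner_right _ _).symm
      have h2 : ⟪e i, F s x⟫_ℂ = if i ∈ s then ⟪T (e i), x⟫_ℂ else 0 := by
        simp only [F, _root_.sum_apply, ContinuousLinearMap.smulRight_apply,
          innerSL_apply_apply, inner_sum, inner_smul_right,
          orthonormal_iff_ite.mp e.orthonormal]
        simp
      rw [_root_.sub_apply, inner_sub_right, h1, h2]
      split_ifs <;> simp
    have hpars : HasSum (fun i => ‖⟪e i, (F s - T) x⟫_ℂ‖ ^ 2) (‖(F s - T) x‖ ^ 2) := by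
      have := e.hasSum_inner_mul_inner ((F s - T) x) ((F s - T) x)
      have h2 := Complex.hasSum_re this
      convert h2 using 1
      · ext i
        rw [← inner_conj_symm ((F s - T) x) (e i), ← Complex.normSq_eq_conj_mul_self,
          Complex.ofReal_re, Complex.normSq_eq_norm_sq]
      · exact norm_sq_eq_re_inner (𝕜 := ℂ) _
    have hs' : HasSum (fun i => if i ∈ s then 0 else ‖T (e i)‖ ^ 2)
        ((∑' i, ‖T (e i)‖ ^ 2) - ∑ i ∈ s, ‖T (e i)‖ ^ 2) := by
      have h1 : HasSum (fun i => if i ∈ s then ‖T (e i)‖ ^ 2 else 0)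
          (∑ i ∈ s, ‖T (e i)‖ ^ 2) := by
        have := hasSum_sum_of_ne_finset_zero (L := .unconditional ι) (f := fun i => if i ∈ s then ‖T (e i)‖ ^ 2 else 0)
          (s := s) (by intro i hi; simp [hi])
        convert this using 1
        exact Finset.sum_congr rfl fun i hi => by simp [hi]
      refine (hs.hasSum.sub h1).congr_fun fun i => ?_
      split_ifs <;> simp
    have hle := hasSum_le (fun i => ?_) hpars (hs'.mul_right (‖x‖ ^ 2))
    · rw [← Real.sqrt_sq (norm_nonneg ((F s - T) x)), ← Real.sqrt_sq (norm_nonneg x),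
        ← Real.sqrt_mul' _ (sq_nonneg _)]
      exact Real.sqrt_le_sqrt hle
    · rw [hc]
      split_ifs
      · simp
      · rw [norm_neg, ← mul_pow]
        gcongr
        exact norm_inner_le_norm _ _
  rw [tendsto_iff_norm_sub_tendsto_zero]
  refine squeeze_zero (fun _ => norm_nonneg _) key ?_
  have h1 : Filter.Tendsto (fun s : Finset ι => (∑' i, ‖T (e i)‖ ^ 2) - ∑ i ∈ s, ‖T (e i)‖ ^ 2)
      Filter.atTop (nhds 0) := by
    have := (tendsto_const_nhds (x := ∑' i, ‖T (e i)‖ ^ 2)).sub hs.hasSum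
    simpa using this
  simpa using h1.sqrt

theorem IsDensityMatrix.isCompactOperator {ρ : H →L[ℂ] H} (h : IsDensityMatrix ρ) :
    IsCompactOperator ρ := by
  obtain ⟨w, e, -⟩ := exists_hilbertBasis ℂ H
  refine isCompactOperator_of_summable_norm_sq e ρ h.isPositive ?_
  obtain ⟨S, hS⟩ := CStarAlgebra.nonneg_iff_eq_star_mul_self.mp
    ((ContinuousLinearMap.nonneg_iff_isPositive ρ).mpr h.isPositive)
  have h1 : Summable fun i => (‖S‖ ^ 2) * (⟪e i, ρ (e i)⟫_ℂ).re :=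
    (Complex.hasSum_re (h.hasTrace_one _ e)).summable.mul_left _
  refine Summable.of_nonneg_of_le (fun _ => sq_nonneg _) (fun i => ?_) h1
  have h2 : (⟪e i, ρ (e i)⟫_ℂ).re = ‖S (e i)‖ ^ 2 := by
    rw [hS, mul_apply_eq_comp, ContinuousLinearMap.star_eq_adjoint,
      ContinuousLinearMap.adjoint_inner_right]
    exact (norm_sq_eq_re_inner (𝕜 := ℂ) _).symm
  rw [h2, ← mul_pow, hS, mul_apply_eq_comp, ContinuousLinearMap.star_eq_adjoint]
  gcongr
  refine (ContinuousLinearMap.le_opNorm _ _).trans ?_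
  rw [LinearIsometryEquiv.norm_map]

/-- Every density matrix has an orthonormal basis of eigenvectors. -/
theorem IsDensityMatrix.nonempty_eigenONB {ρ : H →L[ℂ] H} (h : IsDensityMatrix ρ) :
    Nonempty (EigenONB ρ) := by
  classical
  have hsymm := h.isPositive.isSymmetric
  have hbot := ContinuousLinearMap.orthogonalComplement_iSup_eigenspaces_eq_bot
    h.isCompactOperator hsymm
  let V : ℂ → Submodule ℂ H := fun μ => Module.End.eigenspace (ρ : Module.End ℂ H) μ
  have hcomp : ∀ μ, CompleteSpace (V μ) := fun μ => by
    have : IsClosed (V μ : Set H) := by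
      have : (V μ : Set H) = {x | ρ x = μ • x} := by
        ext x; exact Module.End.mem_eigenspace_iff
      rw [this]
      exact isClosed_eq ρ.continuous (continuous_const_smul μ)
    exact this.completeSpace_coe
  choose w b hb using fun μ => exists_hilbertBasis ℂ (V μ)
  let v : (Σ μ, w μ) → H := fun a => (b a.1 a.2 : V a.1)
  have hv : Orthonormal ℂ v :=
    (LinearMap.IsSymmetric.orthogonalFamily_eigenspaces hsymm).orthonormal_sigma_orthonormal
      (fun μ => (b μ).orthonormal)
  have hspan : (Submodule.span ℂ (Set.range v))ᗮ = ⊥ := by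
    rw [eq_bot_iff, ← hbot]
    refine fun x hx => ?_
    rw [Submodule.mem_orthogonal] at hx ⊢
    have hle : (⨆ μ, V μ) ≤ (ℂ ∙ x)ᗮ := by
      refine iSup_le fun μ y hy => ?_
      rw [Submodule.mem_orthogonal_singleton_iff_inner_left]
      have hs := ((b μ).hasSum_repr ⟨y, hy⟩).mapL (V μ).subtypeL
      have hs2 := hs.mapL (innerSL ℂ x)
      have h0 : ⟪x, y⟫_ℂ = 0 := by
        refine hs2.unique ?_
        convert hasSum_zero with i
        simp only [map_smul, innerSL_apply_apply, Submodule.subtypeL_apply]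
        have := hx (v ⟨μ, i⟩) (Submodule.subset_span ⟨_, rfl⟩)
        rw [← inner_conj_symm, this]
        simp
      rw [← inner_conj_symm, h0, map_zero]
    intro y hy
    exact Submodule.mem_orthogonal_singleton_iff_inner_left.mp (hle hy)
  have heig : ∀ a : (Σ μ, w μ), ρ (v a) = a.1 • v a := fun a =>
    Module.End.mem_eigenspace_iff.mp (b a.1 a.2 : V a.1).2
  have hnn : ∀ a : (Σ μ, w μ), 0 ≤ a.1.re ∧ (a.1.re : ℂ) = a.1 := fun a => by
    have h1 := h.isPositive.inner_nonneg_right (v a)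
    rw [heig, inner_smul_right, inner_self_eq_norm_sq_to_K, hv.1] at h1
    simp only [RCLike.ofReal_one, one_pow, mul_one] at h1
    rw [Complex.le_def] at h1
    refine ⟨h1.1, Complex.ext rfl h1.2⟩
  exact ⟨{ index := Σ μ, w μ
           basis := HilbertBasis.mkOfOrthogonalEqBot hv hspan
           eigenvalue := fun a : (Σ μ, w μ) => ⟨a.1.re, (hnn a).1⟩
           apply_basis := fun a : (Σ μ, w μ) => by
            rw [HilbertBasis.coe_mkOfOrthogonalEqBot, heig]
            exact congrArg (fun c : ℂ => c • v a) (hnn a).2.symm }⟩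

end Operators

section Gaussian

/-- The law of a complex Gaussian random variable with mean `0` and variance `v`: real and imaginary
parts are independent real Gaussians with mean `0` and variance `v / 2` each. -/
noncomputable def complexGaussian (v : ℝ≥0) : Measure ℂ :=
  ((gaussianReal 0 (v / 2)).prod (gaussianReal 0 (v / 2))).map
    (fun q : ℝ × ℝ => (⟨q.1, q.2⟩ : ℂ))

theorem measurable_complex_mk : Measurable (fun q : ℝ × ℝ => (⟨q.1, q.2⟩ : ℂ)) :=
  Complex.measurableEquivRealProd.symm.measurable

instance (v : ℝ≥0) : IsProbabilityMeasure (complexGaussian v) :=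
  Measure.isProbabilityMeasure_map measurable_complex_mk.aemeasurable

theorem lintegral_complexGaussian (v : ℝ≥0) : ∫⁻ z, ‖z‖ₑ ^ 2 ∂(complexGaussian v) = v := by
  have hr : ∫⁻ x, ENNReal.ofReal (x ^ 2) ∂(gaussianReal 0 (v / 2)) = (v / 2 : ℝ≥0) := by
    have h2 : Integrable (fun x : ℝ => x ^ 2) (gaussianReal 0 (v / 2)) :=
      (memLp_id_gaussianReal 2).integrable_sq
    rw [← ofReal_integral_eq_lintegral_ofReal h2 (Filter.Eventually.of_forall fun x => sq_nonneg x)]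
    have := variance_fun_id_gaussianReal (μ := 0) (v := v / 2)
    rw [variance_of_integral_eq_zero (by fun_prop) (by simp)] at this
    rw [this]
    exact ENNReal.ofReal_coe_nnreal
  rw [complexGaussian, lintegral_map (by fun_prop) measurable_complex_mk]
  have h3 : ∀ q : ℝ × ℝ, ‖(⟨q.1, q.2⟩ : ℂ)‖ₑ ^ 2 =
      ENNReal.ofReal (q.1 ^ 2) + ENNReal.ofReal (q.2 ^ 2) := fun q => by
    rw [← ofReal_norm, ← ENNReal.ofReal_pow (norm_nonneg _), ← Complex.normSq_eq_norm_sq,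
      Complex.normSq_mk, ENNReal.ofReal_add (mul_self_nonneg _) (mul_self_nonneg _), sq, sq]
  simp_rw [h3]
  rw [lintegral_add_left (by fun_prop),
    lintegral_prod _ (by fun_prop), lintegral_prod _ (by fun_prop)]
  simp only [lintegral_const, measure_univ, mul_one, hr]
  rw [← ENNReal.coe_add, add_halves]

theorem integral_complexGaussian_exp (v : ℝ≥0) (c : ℂ) :
    ∫ z, Complex.exp (((star z * c).re : ℝ) * Complex.I) ∂(complexGaussian v)
      = Complex.exp (-((v : ℝ) * ‖c‖ ^ 2 / 4 : ℝ)) := by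
  rw [complexGaussian, integral_map measurable_complex_mk.aemeasurable (by fun_prop)]
  have h : ∀ q : ℝ × ℝ, Complex.exp (((star (⟨q.1, q.2⟩ : ℂ) * c).re : ℝ) * Complex.I) =
      Complex.exp (c.re * q.1 * Complex.I) * Complex.exp (c.im * q.2 * Complex.I) := fun q => by
    rw [← Complex.exp_add]
    congr 1
    simp
    ring
  simp_rw [h]
  rw [integral_prod_mul (fun x : ℝ => Complex.exp (c.re * x * Complex.I))
    (fun x : ℝ => Complex.exp (c.im * x * Complex.I)), ← charFun_apply_real, ← charFun_apply_real,
    charFun_gaussianReal, charFun_gaussianReal, ← Complex.exp_add]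
  congr 1
  rw [← Complex.normSq_eq_norm_sq, Complex.normSq_apply]
  push_cast
  ring

end Gaussian

section Coefficients

variable {H : Type u} [NormedAddCommGroup H] [InnerProductSpace ℂ H] {ρ : H →L[ℂ] H}

/-- The joint law of independent centered complex Gaussian coefficients `Z i` with
`E |Z i| ^ 2` equal to the `i`-th eigenvalue. -/
noncomputable abbrev EigenONB.coeffLaw (E : EigenONB ρ) : Measure (E.index → ℂ) :=
  Measure.infinitePi fun i => complexGaussian (E.eigenvalue i)

theorem EigenONB.tsum_eigenvalue (E : EigenONB ρ) (hρ : IsDensityMatrix ρ) :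
    ∑' i, (E.eigenvalue i : ℝ≥0∞) = 1 := by
  have h := hρ.hasTrace_one _ E.basis
  simp only [E.apply_basis, inner_smul_right, inner_self_eq_norm_sq_to_K,
    E.basis.orthonormal.1] at h
  have h2 : HasSum (fun i => (E.eigenvalue i : ℝ)) 1 := by
    have := Complex.hasSum_re h
    simpa using this
  have h3 : HasSum E.eigenvalue 1 := NNReal.hasSum_coe.mp h2
  exact (ENNReal.hasSum_coe.mpr h3).tsum_eq

variable [TopologicalSpace.SeparableSpace H]

theorem EigenONB.countable_index (E : EigenONB ρ) : Countable E.index := by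
  refine Pairwise.countable_of_isOpen_disjoint (s := fun i => Metric.ball (E.basis i) (1 / 2))
    (fun i j hij => ?_) (fun _ => Metric.isOpen_ball) (fun i => ⟨_, Metric.mem_ball_self (by norm_num)⟩)
  refine Metric.ball_disjoint_ball ?_
  have h := E.basis.orthonormal
  have h1 : ‖E.basis i - E.basis j‖ ^ 2 = 2 := by
    rw [@norm_sub_sq ℂ, h.1, h.1, h.2 hij]
    norm_num
  rw [dist_eq_norm]
  nlinarith [norm_nonneg (E.basis i - E.basis j)]

theorem EigenONB.lintegral_coeffLaw (E : EigenONB ρ) (hρ : IsDensityMatrix ρ) :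
    ∫⁻ z, ∑' i, ‖z i‖ₑ ^ 2 ∂E.coeffLaw = 1 := by
  have := E.countable_index
  rw [lintegral_tsum fun i => Measurable.aemeasurable (by fun_prop), ← E.tsum_eigenvalue hρ]
  congr 1
  ext i
  rw [← lintegral_complexGaussian, ← Measure.infinitePi_map_eval
    (fun i => complexGaussian (E.eigenvalue i)) i, lintegral_map (by fun_prop) (by fun_prop)]

variable [CompleteSpace H]

theorem EigenONB.ae_summable (E : EigenONB ρ) (hρ : IsDensityMatrix ρ) :
    ∀ᵐ z ∂E.coeffLaw, Summable fun i => z i • E.basis i := by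
  have := E.countable_index
  have h1 := ae_lt_top (μ := E.coeffLaw) (f := fun z => ∑' i, ‖z i‖ₑ ^ 2)
    (Measurable.tsum fun i => by fun_prop) (by rw [E.lintegral_coeffLaw hρ]; simp)
  filter_upwards [h1] with z hz
  have h2 : Summable fun i => ‖z i‖ ^ 2 := by
    have h3 : Summable fun i => ‖z i‖₊ ^ 2 := by
      rw [← ENNReal.tsum_coe_ne_top_iff_summable]
      simpa [enorm] using hz.ne
    exact NNReal.summable_coe.mpr h3
  exact ((E.basis.orthonormal.orthogonalFamily).summable_iff_norm_sq_summable z).mpr h2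

end Coefficients

section GAP

variable {H : Type u} [NormedAddCommGroup H] [InnerProductSpace ℂ H]
  [MeasurableSpace H]

/-- The Gaussian measure `G(ρ)`: the law of `∑ i, Z i • b i`, where `b` is an orthonormal eigenbasis
of `ρ`. The series converges almost surely (`EigenONB.ae_summable`). -/
noncomputable def EigenONB.gaussian {ρ : H →L[ℂ] H} (E : EigenONB ρ) : Measure H :=
  E.coeffLaw.map
    (fun z : E.index → ℂ => ∑' i, z i • E.basis i)

/-- The adjusted measure, with density `‖ψ‖ ^ 2` relative to `μ`. -/
noncomputable def adjust (μ : Measure H) : Measure H :=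
  μ.withDensity fun ψ => ‖ψ‖ₑ ^ 2

/-- The law on the unit sphere of `ψ / ‖ψ‖`, for `ψ` distributed according to a measure without
atom at `0`. -/
noncomputable def projectToSphere (μ : Measure H) : Measure (Metric.sphere (0 : H) 1) :=
  (μ.map fun ψ => (‖ψ‖⁻¹ : ℝ) • ψ).comap Subtype.val

variable [CompleteSpace H]

/-- The measure `GAP(ρ)`: the law on the unit sphere of `ψ / ‖ψ‖`, where the law of `ψ` has density
`‖ψ‖ ^ 2` relative to the Gaussian measure `G(ρ)`. It does not depend on the eigenbasis used to
define `G(ρ)` (`GAP_eq`), and it is a probability measure (`isProbabilityMeasure_GAP`). -/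
noncomputable def GAP (ρ : H →L[ℂ] H) (hρ : IsDensityMatrix ρ) :
    Measure (Metric.sphere (0 : H) 1) :=
  projectToSphere (adjust hρ.nonempty_eigenONB.some.gaussian)

variable [BorelSpace H] [TopologicalSpace.SeparableSpace H] {ρ : H →L[ℂ] H}

theorem EigenONB.aemeasurable_tsum (E : EigenONB ρ) (hρ : IsDensityMatrix ρ) :
    AEMeasurable (fun z : E.index → ℂ => ∑' i, z i • E.basis i) E.coeffLaw := by
  have := E.countable_index
  have := UniformSpace.secondCountable_of_separable H
  refine aemeasurable_of_tendsto_metrizable_ae (u := Filter.atTop)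
    (f := fun (s : Finset E.index) z => ∑ i ∈ s, z i • E.basis i) (fun s => ?_) ?_
  · exact Measurable.aemeasurable (by fun_prop)
  · filter_upwards [E.ae_summable hρ] with z hz using hz.hasSum

theorem EigenONB.isProbabilityMeasure_gaussian (E : EigenONB ρ) (hρ : IsDensityMatrix ρ) :
    IsProbabilityMeasure E.gaussian :=
  Measure.isProbabilityMeasure_map (E.aemeasurable_tsum hρ)

theorem EigenONB.isProbabilityMeasure_adjust (E : EigenONB ρ) (hρ : IsDensityMatrix ρ) :
    IsProbabilityMeasure (adjust E.gaussian) := by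
  constructor
  rw [adjust, withDensity_apply _ MeasurableSet.univ, Measure.restrict_univ, EigenONB.gaussian,
    lintegral_map' (by fun_prop) (E.aemeasurable_tsum hρ), ← E.lintegral_coeffLaw hρ]
  refine lintegral_congr_ae ?_
  filter_upwards [E.ae_summable hρ] with z hz
  have h1 := hz.hasSum
  have h2 := (E.basis.orthonormal.orthogonalFamily.summable_iff_norm_sq_summable z).mp hz
  have h3 : ‖∑' i, z i • E.basis i‖ ^ 2 = ∑' i, ‖z i‖ ^ 2 := by
    refine tendsto_nhds_unique (((continuous_norm.tendsto _).comp h1).pow 2) ?_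
    refine h2.hasSum.congr fun s => ?_
    exact (E.basis.orthonormal.orthogonalFamily.norm_sum z s).symm
  simp only [← ofReal_norm, ← ENNReal.ofReal_pow (norm_nonneg _)]
  rw [h3, ENNReal.ofReal_tsum_of_nonneg (fun _ => sq_nonneg _) h2]

/-- The characteristic function of `G(ρ)`. -/
theorem EigenONB.integral_exp_gaussian (E : EigenONB ρ) (hρ : IsDensityMatrix ρ) (t : H) :
    ∫ x, Complex.exp (((⟪x, t⟫_ℂ).re : ℝ) * Complex.I) ∂E.gaussian = Complex.exp (-((⟪t, ρ t⟫_ℂ).re / 4 : ℝ)) := by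
  have := E.countable_index
  rw [EigenONB.gaussian, integral_map (E.aemeasurable_tsum hρ) (by fun_prop)]
  have hfin : ∀ s : Finset E.index,
      ∫ z, Complex.exp (((⟪∑ i ∈ s, z i • E.basis i, t⟫_ℂ).re : ℝ) * Complex.I) ∂E.coeffLaw =
      Complex.exp (-((∑ i ∈ s, (E.eigenvalue i : ℝ) * ‖⟪E.basis i, t⟫_ℂ‖ ^ 2) / 4 : ℝ)) := by
    intro s
    have h1 : ∀ z : E.index → ℂ,
        Complex.exp (((⟪∑ i ∈ s, z i • E.basis i, t⟫_ℂ).re : ℝ) * Complex.I) =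
        (fun y : s → ℂ => ∏ i, Complex.exp (((star (y i) * ⟪E.basis i, t⟫_ℂ).re : ℝ) * Complex.I))
          (s.restrict z) := by
      intro z
      simp only [Finset.restrict]
      rw [Finset.prod_coe_sort s (fun i => Complex.exp (((star (z i) *
        ⟪E.basis i, t⟫_ℂ).re : ℝ) * Complex.I)), ← Complex.exp_sum, ← Finset.sum_mul, sum_inner, Complex.re_sum]
      congr 2
      push_cast
      refine Finset.sum_congr rfl fun i _ => ?_
      congr 2
      rw [inner_smul_left]
      rfl
    rw [integral_congr_ae (Filter.Eventually.of_forall h1),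
      integral_restrict_infinitePi (μ := fun i => complexGaussian (E.eigenvalue i))
        (f := fun y : s → ℂ => ∏ i, Complex.exp (((star (y i) *
          ⟪E.basis i, t⟫_ℂ).re : ℝ) * Complex.I))
        (Measurable.aestronglyMeasurable (by fun_prop)),
      integral_fintype_prod_eq_prod (fun (i : s) (y : ℂ) =>
        Complex.exp (((star y * ⟪E.basis i, t⟫_ℂ).re : ℝ) * Complex.I))]
    simp_rw [integral_complexGaussian_exp]
    rw [Finset.prod_coe_sort s (fun i => Complex.exp (-((E.eigenvalue i : ℝ) *
        ‖⟪E.basis i, t⟫_ℂ‖ ^ 2 / 4 : ℝ))), ← Complex.exp_sum]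
    congr 1
    push_cast
    rw [Finset.sum_neg_distrib, Finset.sum_div]
  have hlim1 : Filter.Tendsto (fun s : Finset E.index =>
      ∫ z, Complex.exp (((⟪∑ i ∈ s, z i • E.basis i, t⟫_ℂ).re : ℝ) * Complex.I) ∂E.coeffLaw)
      Filter.atTop
      (nhds (∫ z, Complex.exp (((⟪∑' i, z i • E.basis i, t⟫_ℂ).re : ℝ) * Complex.I) ∂E.coeffLaw)) := by
    refine tendsto_integral_filter_of_dominated_convergence (fun _ => 1)
      (Filter.Eventually.of_forall fun s => ?_) (Filter.Eventually.of_forall fun s => ?_)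
      (integrable_const _) ?_
    · have : Measurable fun z : E.index → ℂ => ∑ i ∈ s, z i • E.basis i := by fun_prop
      have h2 : Continuous fun x : H => Complex.exp (((⟪x, t⟫_ℂ).re : ℝ) * Complex.I) := by fun_prop
      exact (h2.measurable.comp this).aestronglyMeasurable
    · exact Filter.Eventually.of_forall fun z => (Complex.norm_exp_ofReal_mul_I _).le
    · filter_upwards [E.ae_summable hρ] with z hz
      have h2 : Continuous fun x : H => Complex.exp (((⟪x, t⟫_ℂ).re : ℝ) * Complex.I) := by fun_prop
      exact (h2.tendsto _).comp hz.hasSum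
  have hsum : HasSum (fun i => (E.eigenvalue i : ℝ) * ‖⟪E.basis i, t⟫_ℂ‖ ^ 2) (⟪t, ρ t⟫_ℂ).re := by
    have h1 := Complex.hasSum_re (E.basis.hasSum_inner_mul_inner t (ρ t))
    convert h1 using 1
    ext i
    rw [← hρ.isPositive.inner_left_eq_inner_right, E.apply_basis, inner_smul_left,
      ← inner_conj_symm t, Complex.conj_ofReal, mul_left_comm,
      ← Complex.normSq_eq_conj_mul_self, ← Complex.ofReal_mul, Complex.ofReal_re,
      Complex.normSq_eq_norm_sq]
  refine tendsto_nhds_unique hlim1 ?_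
  simp_rw [hfin]
  have h3 : Continuous fun x : ℝ => Complex.exp (-(x / 4 : ℝ)) := by fun_prop
  exact (h3.tendsto _).comp hsum

/-- `GAP(ρ)` may be computed in any orthonormal eigenbasis of `ρ`. -/
theorem GAP_eq (hρ : IsDensityMatrix ρ) (E : EigenONB ρ) :
    GAP ρ hρ = projectToSphere (adjust E.gaussian) := by
  have h1 := E.isProbabilityMeasure_gaussian hρ
  have h2 := hρ.nonempty_eigenONB.some.isProbabilityMeasure_gaussian hρ
  have := UniformSpace.secondCountable_of_separable H
  let _ : InnerProductSpace ℝ H := InnerProductSpace.complexToReal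
  have h3 : hρ.nonempty_eigenONB.some.gaussian = E.gaussian := by
    refine Measure.ext_of_charFun (funext fun t => ?_)
    exact (EigenONB.integral_exp_gaussian _ hρ t).trans (E.integral_exp_gaussian hρ t).symm
  rw [GAP, h3]

theorem isProbabilityMeasure_GAP (hρ : IsDensityMatrix ρ) : IsProbabilityMeasure (GAP ρ hρ) := by
  constructor
  have := hρ.nonempty_eigenONB.some.isProbabilityMeasure_adjust hρ
  set E := hρ.nonempty_eigenONB.some
  have hm : Measurable fun ψ : H => (‖ψ‖⁻¹ : ℝ) • ψ := by fun_prop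
  rw [GAP, projectToSphere, comap_subtype_coe_apply Metric.isClosed_sphere.measurableSet,
    Set.image_univ, Subtype.range_coe, Measure.map_apply hm Metric.isClosed_sphere.measurableSet,
    ← Measure.restrict_univ (μ := adjust _)]
  have h0 : ∀ᵐ ψ ∂adjust E.gaussian, ψ ≠ 0 := by
    rw [adjust, ae_withDensity_iff (by fun_prop)]
    exact Filter.Eventually.of_forall fun ψ h h' => h (by simp [h'])
  rw [Measure.restrict_univ, ← measure_univ (μ := adjust E.gaussian)]
  refine measure_congr ?_
  filter_upwards [h0] with ψ hψ
  refine eq_true ?_ |>.trans (eq_true trivial).symm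
  change (‖ψ‖⁻¹ : ℝ) • ψ ∈ Metric.sphere (0 : H) 1
  rw [mem_sphere_zero_iff_norm, norm_smul, norm_inv, norm_norm,
    inv_mul_cancel₀ (norm_ne_zero_iff.mpr hψ)]

end GAP
end GapMeasure

/-! The deviation event is homogeneous: for `ψ ≠ 0`, the normalised vector deviates by more than `ε`
iff `|⟨ψ|B|ψ⟩ - t‖ψ‖²| > ε‖ψ‖²`, with `t = tr(ρB)`. So the sphere can be dropped, and the event is
measured under the Gaussian law weighted by `‖ψ‖²`. Since `‖z‖ / 2 ≤ Re (c z)` for some `c` among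
`±1, ±i`, the event lies in the union of the four events `Re⟨ψ, M ψ⟩ > 0` with `M = c (B - t) - ε /
2`, whose Gaussian mean is `-ε / 2`.

Each of these is a Chernoff estimate. For symmetric `M` and finitely many coordinates, diagonalising
`√ρ M √ρ` turns the form into `∑ d_j |z_j|²` with independent standard `z_j`, where `∑ d_j` is the
mean and `∑ d_j² ≤ ‖ρ‖ ‖M‖²` because `tr ρ = 1`. With `E exp (a|z|²) = 1 / (1 - a) ≤ exp (a + a²)`
this gives `E exp (l Re⟨ψ, M ψ⟩) ≤ exp (l τ + l² ‖ρ‖ ‖M‖²)` for small `l ≥ 0`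
(`lintegral_exp_quadratic_finite_le`). Fatou's lemma carries it to infinite dimension, and
symmetrisation to arbitrary `M`.

The weight `‖ψ‖²` is split off by the inequality of arithmetic and geometric means against a fourth
moment (`EigenONB.adjust_quadratic_pos_le`). The resulting constant 1 / 288 is better than required.
-/

namespace GapMeasure

/-! ### Trace of `ρ B` and its expression in an eigenbasis -/

section Trace

variable {H : Type u} [NormedAddCommGroup H] [InnerProductSpace ℂ H]
  {ρ : H →L[ℂ] H}

theorem EigenONB.hasSum_eigenvalue (E : EigenONB ρ) (hρ : IsDensityMatrix ρ) :
    HasSum (fun i => (E.eigenvalue i : ℝ)) 1 := by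
  have h := hρ.hasTrace_one _ E.basis
  simp only [E.apply_basis, inner_smul_right, inner_self_eq_norm_sq_to_K,
    E.basis.orthonormal.1] at h
  simpa using Complex.hasSum_re h

theorem EigenONB.eigenvalue_le_opNorm (E : EigenONB ρ) (i : E.index) :
    (E.eigenvalue i : ℝ) ≤ ‖ρ‖ := by
  have h := ρ.le_opNorm (E.basis i)
  rw [E.apply_basis, norm_smul, E.basis.orthonormal.1] at h
  simpa using h

theorem hasSum_norm_inner_sq {ι : Type*} (e : HilbertBasis ι ℂ H) (x : H) :
    HasSum (fun i => ‖⟪e i, x⟫_ℂ‖ ^ 2) (‖x‖ ^ 2) := by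
  have h2 := Complex.hasSum_re (e.hasSum_inner_mul_inner x x)
  convert h2 using 1
  · ext i
    rw [← inner_conj_symm x (e i), ← Complex.normSq_eq_conj_mul_self,
      Complex.ofReal_re, Complex.normSq_eq_norm_sq]
  · exact norm_sq_eq_re_inner (𝕜 := ℂ) _

theorem summable_norm_inner_mul_norm_inner {ι : Type*} (e : HilbertBasis ι ℂ H) (x y : H) :
    Summable (fun i => ‖⟪x, e i⟫_ℂ‖ * ‖⟪e i, y⟫_ℂ‖) := by
  refine Summable.of_nonneg_of_le (fun _ => by positivity) (fun i => ?_)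
    ((hasSum_norm_inner_sq e x).summable.add (hasSum_norm_inner_sq e y).summable)
  rw [norm_inner_symm]
  nlinarith [sq_nonneg (‖⟪e i, x⟫_ℂ‖ - ‖⟪e i, y⟫_ℂ‖), sq_nonneg (‖⟪e i, x⟫_ℂ‖),
    sq_nonneg (‖⟪e i, y⟫_ℂ‖)]

/-- `ab ≤ (a² + b²) / 2` termwise, then Parseval twice. The bound is uniform over unit vectors up to
`‖B‖`, which is what makes the double series for `tr(ρB)` absolutely convergent. -/
theorem tsum_norm_inner_mul_norm_inner_le {ι : Type*} (e : HilbertBasis ι ℂ H) (x y : H) :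
    ∑' i, ‖⟪x, e i⟫_ℂ‖ * ‖⟪e i, y⟫_ℂ‖ ≤ (‖x‖ ^ 2 + ‖y‖ ^ 2) / 2 := by
  have h := ((hasSum_norm_inner_sq e x).add (hasSum_norm_inner_sq e y)).div_const 2
  refine hasSum_le (fun i => ?_) (summable_norm_inner_mul_norm_inner e x y).hasSum h
  rw [norm_inner_symm]
  nlinarith [sq_nonneg (‖⟪e i, x⟫_ℂ‖ - ‖⟪e i, y⟫_ℂ‖)]

theorem EigenONB.hasSum_trace (E : EigenONB ρ) (hρ : IsDensityMatrix ρ) {B : H →L[ℂ] H} {t : ℂ}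
    (ht : HasTrace (ρ ∘L B) t) :
    HasSum (fun i => (E.eigenvalue i : ℂ) * ⟪E.basis i, B (E.basis i)⟫_ℂ) t := by
  refine (ht _ E.basis).congr_fun fun i => ?_
  rw [ContinuousLinearMap.comp_apply, ← hρ.isPositive.inner_left_eq_inner_right, E.apply_basis,
    inner_smul_left, Complex.conj_ofReal]

theorem norm_inner_apply_self_le (B : H →L[ℂ] H) (x : H) : ‖⟪x, B x⟫_ℂ‖ ≤ ‖B‖ * ‖x‖ ^ 2 := by
  refine (norm_inner_le_norm _ _).trans ?_
  nlinarith [mul_le_mul_of_nonneg_left (B.le_opNorm x) (norm_nonneg x)]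

variable [CompleteSpace H]

/-- The trace of `ρ B` is the mean of the diagonal elements of `B` in an eigenbasis of `ρ`,
weighted by the eigenvalues. -/
theorem EigenONB.hasTrace_comp (E : EigenONB ρ) (hρ : IsDensityMatrix ρ) (B : H →L[ℂ] H) :
    HasTrace (ρ ∘L B) (∑' n, (E.eigenvalue n : ℂ) * ⟪E.basis n, B (E.basis n)⟫_ℂ) := by
  intro ι e
  -- Inserting both bases gives a double series: summed over `i` first it yields the eigenbasis
  -- expression, summed over `n` first the diagonal elements in `e`. Absolute summability permits
  -- the exchange.
  let F : E.index × ι → ℂ := fun a =>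
    (E.eigenvalue a.1 : ℂ) * (⟪B.adjoint (E.basis a.1), e a.2⟫_ℂ * ⟪e a.2, E.basis a.1⟫_ℂ)
  have hnorm : ∀ n i, ‖F (n, i)‖ = (E.eigenvalue n : ℝ) *
      (‖⟪B.adjoint (E.basis n), e i⟫_ℂ‖ * ‖⟪e i, E.basis n⟫_ℂ‖) := fun n i => by
    simp [F]
  have hF : Summable F := by
    rw [← summable_norm_iff, summable_prod_of_nonneg fun _ => norm_nonneg _]
    simp only [hnorm]
    refine ⟨fun n => (summable_norm_inner_mul_norm_inner e _ _).mul_left _, ?_⟩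
    simp only [tsum_mul_left]
    refine Summable.of_nonneg_of_le (fun n => by positivity) (fun n => ?_)
      ((E.hasSum_eigenvalue hρ).summable.mul_right ((‖B.adjoint‖ ^ 2 + 1 ^ 2) / 2))
    gcongr
    refine (tsum_norm_inner_mul_norm_inner_le e _ _).trans ?_
    have := B.adjoint.le_opNorm (E.basis n)
    rw [E.basis.orthonormal.1, mul_one] at this
    rw [E.basis.orthonormal.1]
    gcongr
  have h1 : ∑' a, F a = ∑' n, (E.eigenvalue n : ℂ) * ⟪E.basis n, B (E.basis n)⟫_ℂ := by
    rw [hF.tsum_prod]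
    refine tsum_congr fun n => ?_
    simp only [F]
    rw [tsum_mul_left, e.tsum_inner_mul_inner, ContinuousLinearMap.adjoint_inner_left]
  rw [← h1]
  have h2 := (Equiv.prodComm ι E.index).hasSum_iff.mpr hF.hasSum
  refine h2.prod_fiberwise fun i => ?_
  have h3 := E.basis.hasSum_inner_mul_inner (e i) ((ρ ∘L B) (e i))
  refine h3.congr_fun fun n => ?_
  simp only [Function.comp_apply, Equiv.prodComm_apply, Prod.swap_prod_mk, F,
    ContinuousLinearMap.comp_apply]
  rw [← hρ.isPositive.inner_left_eq_inner_right, E.apply_basis, inner_smul_left,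
    ContinuousLinearMap.adjoint_inner_left, Complex.conj_ofReal]
  ring

/-- The trace is an average of diagonal elements of `B`, each of modulus at most `‖B‖`, with the
eigenvalues as probability weights. -/
theorem norm_trace_le (hρ : IsDensityMatrix ρ) {B : H →L[ℂ] H} {t : ℂ}
    (ht : HasTrace (ρ ∘L B) t) : ‖t‖ ≤ ‖B‖ := by
  obtain ⟨E⟩ := hρ.nonempty_eigenONB
  have h1 := (E.hasSum_eigenvalue hρ).mul_right ‖B‖
  rw [one_mul] at h1
  rw [← (E.hasSum_trace hρ ht).tsum_eq]
  refine tsum_of_norm_bounded h1 fun i => ?_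
  rw [norm_mul, Complex.norm_real, Real.norm_eq_abs, abs_of_nonneg (E.eigenvalue i).coe_nonneg]
  gcongr
  simpa [E.basis.orthonormal.1] using norm_inner_apply_self_le B (E.basis i)

theorem IsDensityMatrix.norm_pos (hρ : IsDensityMatrix ρ) : 0 < ‖ρ‖ := by
  refine norm_pos_iff.mpr fun h => ?_
  obtain ⟨E⟩ := hρ.nonempty_eigenONB
  have h1 := hρ.hasTrace_one _ E.basis
  simp only [h, _root_.zero_apply, inner_zero_right] at h1
  exact zero_ne_one (hasSum_zero.unique h1)

end Trace

/-! ### Exponential moments of squared moduli of standard complex Gaussians -/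

section Chernoff

theorem inv_one_sub_le_exp {a : ℝ} (ha : |a| ≤ 1 / 2) : (1 - a)⁻¹ ≤ Real.exp (a + a ^ 2) := by
  obtain ⟨h1, h2⟩ := abs_le.mp ha
  rw [inv_le_iff_one_le_mul₀ (by linarith)]
  rcases le_total a 0 with h | h
  -- Here `(1 + a + a²)(1 - a) = 1 - a³ ≥ 1`.
  · have := Real.add_one_le_exp (a + a ^ 2)
    nlinarith [mul_le_mul_of_nonneg_right this (by linarith : 0 ≤ 1 - a),
      mul_nonneg (sq_nonneg a) (by linarith : 0 ≤ -a)]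
  -- For `a > 0` the linear bound is too weak; the quadratic term contributes `a² (1 - a)(1 + a)² /
  -- 2`, which absorbs `a³` for `a ≤ 1 / 2`.
  · have := Real.quadratic_le_exp_of_nonneg (x := a + a ^ 2) (by positivity)
    have h3 := mul_le_mul_of_nonneg_right this (by linarith : 0 ≤ 1 - a)
    refine le_trans ?_ h3
    have h4 : 0 ≤ a ^ 2 * ((1 - a) * (1 + a) ^ 2 / 2 - a) := by
      refine mul_nonneg (sq_nonneg a) ?_
      nlinarith [mul_nonneg h (by linarith : 0 ≤ 1 / 2 - a), mul_nonneg (mul_nonneg h h) (by linarith : 0 ≤ 1 / 2 - a)]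
    nlinarith [h4]

/-- No bound on `a` is needed: for `a ≥ 1` the integral diverges and is 0 by convention, as is the
right-hand side. -/
theorem integral_exp_sq_gaussianReal (a : ℝ) :
    ∫ x, Real.exp (a * x ^ 2) ∂(gaussianReal 0 (1 / 2)) = (√(1 - a))⁻¹ := by
  rw [integral_gaussianReal_eq_integral_smul (by simp)]
  have h : ∀ x : ℝ, gaussianPDFReal 0 (1 / 2) x • Real.exp (a * x ^ 2) =
      (√Real.pi)⁻¹ * Real.exp (-(1 - a) * x ^ 2) := fun x => by
    rw [gaussianPDFReal, smul_eq_mul, mul_assoc, ← Real.exp_add]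
    congr 2
    · congr 1
      push_cast
      ring
    · push_cast
      ring
  simp_rw [h]
  rw [integral_const_mul, integral_gaussian, Real.sqrt_div Real.pi_pos.le]
  have : √Real.pi ≠ 0 := (Real.sqrt_pos.mpr Real.pi_pos).ne'
  field_simp

theorem integral_exp_complexGaussian {a : ℝ} (ha : a < 1) :
    ∫ z, Real.exp (a * ‖z‖ ^ 2) ∂(complexGaussian 1) = (1 - a)⁻¹ := by
  rw [complexGaussian, integral_map measurable_complex_mk.aemeasurable (by fun_prop)]
  have h : ∀ q : ℝ × ℝ, Real.exp (a * ‖(⟨q.1, q.2⟩ : ℂ)‖ ^ 2) =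
      Real.exp (a * q.1 ^ 2) * Real.exp (a * q.2 ^ 2) := fun q => by
    rw [← Real.exp_add, ← Complex.normSq_eq_norm_sq, Complex.normSq_mk]
    ring_nf
  simp_rw [h]
  rw [integral_prod_mul (fun x : ℝ => Real.exp (a * x ^ 2)) (fun x : ℝ => Real.exp (a * x ^ 2)),
    integral_exp_sq_gaussianReal a, ← mul_inv, Real.mul_self_sqrt (by linarith)]

theorem lintegral_exp_complexGaussian_le {a : ℝ} (ha : |a| ≤ 1 / 2) :
    ∫⁻ z, ENNReal.ofReal (Real.exp (a * ‖z‖ ^ 2)) ∂(complexGaussian 1) ≤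
      ENNReal.ofReal (Real.exp (a + a ^ 2)) := by
  have h1 : a < 1 := by linarith [(abs_le.mp ha).2]
  have h2 := integral_exp_complexGaussian h1
  -- A non-integrable function would have Bochner integral 0.
  have h3 : Integrable (fun z : ℂ => Real.exp (a * ‖z‖ ^ 2)) (complexGaussian 1) :=
    Integrable.of_integral_ne_zero (by rw [h2]; exact inv_ne_zero (by linarith))
  rw [← ofReal_integral_eq_lintegral_ofReal h3
    (Filter.Eventually.of_forall fun _ => (Real.exp_pos _).le), h2]
  exact ENNReal.ofReal_le_ofReal (inv_one_sub_le_exp ha)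

theorem lintegral_exp_sum_complexGaussian_le {ι : Type*} [Fintype ι] {a : ι → ℝ}
    (ha : ∀ i, |a i| ≤ 1 / 2) :
    ∫⁻ z : ι → ℂ, ENNReal.ofReal (Real.exp (∑ i, a i * ‖z i‖ ^ 2))
        ∂(Measure.pi fun _ => complexGaussian 1) ≤
      ENNReal.ofReal (Real.exp (∑ i, (a i + a i ^ 2))) := by
  have h1 : ∀ z : ι → ℂ, ENNReal.ofReal (Real.exp (∑ i, a i * ‖z i‖ ^ 2)) =
      ∏ i, ENNReal.ofReal (Real.exp (a i * ‖z i‖ ^ 2)) := fun z => by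
    rw [Real.exp_sum, ENNReal.ofReal_prod_of_nonneg fun _ _ => (Real.exp_pos _).le]
  simp_rw [h1]
  rw [Real.exp_sum, ENNReal.ofReal_prod_of_nonneg fun _ _ => (Real.exp_pos _).le]
  have hind : iIndepFun (fun i (z : ι → ℂ) => ENNReal.ofReal (Real.exp (a i * ‖z i‖ ^ 2)))
      (Measure.pi fun _ => complexGaussian 1) :=
    iIndepFun_pi (X := fun i (z : ℂ) => ENNReal.ofReal (Real.exp (a i * ‖z‖ ^ 2)))
      fun i => Measurable.aemeasurable (by fun_prop)
  rw [lintegral_prod_eq_prod_lintegral_of_indepFun _ _ hind fun i => by fun_prop]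
  refine Finset.prod_le_prod' fun i _ => ?_
  exact ((measurePreserving_eval (fun _ : ι => complexGaussian 1) i).lintegral_comp
    (f := fun z : ℂ => ENNReal.ofReal (Real.exp (a i * ‖z‖ ^ 2))) (by fun_prop)).trans_le
    (lintegral_exp_complexGaussian_le (ha i))

end Chernoff

/-! ### Gaussian quadratic forms in finitely many coordinates -/

section QuadraticForm

variable {H : Type u} [NormedAddCommGroup H] [InnerProductSpace ℂ H]

/-- The characteristic function of a finite Gaussian combination of vectors. -/
theorem integral_exp_inner_sum_complexGaussian {ι : Type*} [Fintype ι] (v : ι → ℝ≥0) (f : ι → H)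
    (t : H) :
    ∫ z : ι → ℂ, Complex.exp (((⟪∑ i, z i • f i, t⟫_ℂ).re : ℝ) * Complex.I)
        ∂(Measure.pi fun i => complexGaussian (v i)) =
      Complex.exp (-((∑ i, (v i : ℝ) * ‖⟪f i, t⟫_ℂ‖ ^ 2) / 4 : ℝ)) := by
  have h1 : ∀ z : ι → ℂ, Complex.exp (((⟪∑ i, z i • f i, t⟫_ℂ).re : ℝ) * Complex.I) =
      ∏ i, Complex.exp (((star (z i) * ⟪f i, t⟫_ℂ).re : ℝ) * Complex.I) := fun z => by
    rw [← Complex.exp_sum, ← Finset.sum_mul, sum_inner, Complex.re_sum]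
    push_cast
    simp_rw [inner_smul_left]
    rfl
  simp_rw [h1]
  rw [integral_fintype_prod_eq_prod (fun i (y : ℂ) =>
    Complex.exp (((star y * ⟪f i, t⟫_ℂ).re : ℝ) * Complex.I))]
  simp_rw [integral_complexGaussian_exp]
  rw [← Complex.exp_sum]
  congr 1
  push_cast
  rw [Finset.sum_neg_distrib, Finset.sum_div]

variable [CompleteSpace H] [MeasurableSpace H] [BorelSpace H] [TopologicalSpace.SeparableSpace H]

/-- Two finite Gaussian combinations of vectors with the same covariance have the same law. -/
theorem map_sum_complexGaussian_eq {ι κ : Type*} [Fintype ι] [Fintype κ] (v : ι → ℝ≥0)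
    (w : κ → ℝ≥0) (f : ι → H) (g : κ → H)
    (h : ∀ t, ∑ i, (v i : ℝ) * ‖⟪f i, t⟫_ℂ‖ ^ 2 = ∑ k, (w k : ℝ) * ‖⟪g k, t⟫_ℂ‖ ^ 2) :
    (Measure.pi fun i => complexGaussian (v i)).map (fun z => ∑ i, z i • f i) =
      (Measure.pi fun k => complexGaussian (w k)).map (fun z => ∑ k, z k • g k) := by
  have := UniformSpace.secondCountable_of_separable H
  let _ : InnerProductSpace ℝ H := InnerProductSpace.complexToReal
  have hm1 : Measurable fun z : ι → ℂ => ∑ i, z i • f i := by fun_prop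
  have hm2 : Measurable fun z : κ → ℂ => ∑ k, z k • g k := by fun_prop
  have := Measure.isProbabilityMeasure_map
    (μ := Measure.pi fun i => complexGaussian (v i)) hm1.aemeasurable
  have := Measure.isProbabilityMeasure_map
    (μ := Measure.pi fun k => complexGaussian (w k)) hm2.aemeasurable
  refine Measure.ext_of_charFun (funext fun t => ?_)
  -- The real inner product underlying `charFun` is the real part of the complex one.
  change ∫ x, Complex.exp (((⟪x, t⟫_ℂ).re : ℝ) * Complex.I) ∂_ =
    ∫ x, Complex.exp (((⟪x, t⟫_ℂ).re : ℝ) * Complex.I) ∂_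
  rw [integral_map hm1.aemeasurable (by fun_prop), integral_map hm2.aemeasurable (by fun_prop),
    integral_exp_inner_sum_complexGaussian, integral_exp_inner_sum_complexGaussian, h]

/-- A Gaussian law depends only on its covariance, so the basis `e` may be traded for one that
diagonalises the form. The bound involves only `P`, `N` and `∑ p i ≤ 1`, not the number of
coordinates, and therefore survives the passage to infinite dimension. -/
theorem lintegral_exp_quadratic_finite_le {ι : Type*} [Fintype ι] {e : ι → H}
    (he : Orthonormal ℂ e) {p : ι → ℝ≥0} {P N l : ℝ} (hP : ∀ i, (p i : ℝ) ≤ P)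
    (hp : ∑ i, (p i : ℝ) ≤ 1) {M : H →L[ℂ] H} (hM : (M : H →ₗ[ℂ] H).IsSymmetric) (hN : ‖M‖ ≤ N)
    (hl : 0 ≤ l) (hlPN : l * (P * N) ≤ 1 / 2) (hP0 : 0 ≤ P) :
    ∫⁻ z : ι → ℂ, ENNReal.ofReal (Real.exp (l * (⟪∑ i, z i • e i, M (∑ i, z i • e i)⟫_ℂ).re))
        ∂(Measure.pi fun i => complexGaussian (p i)) ≤
      ENNReal.ofReal (Real.exp (l * ∑ i, (p i : ℝ) * (⟪e i, M (e i)⟫_ℂ).re +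
        l ^ 2 * (P * N ^ 2))) := by
  classical
  have := UniformSpace.secondCountable_of_separable H
  have hN0 : 0 ≤ N := (norm_nonneg M).trans hN
  let b : OrthonormalBasis ι ℂ (EuclideanSpace ℂ ι) := EuclideanSpace.basisFun ι ℂ
  -- `R` plays the role of `√ρ`: it maps a standard Gaussian vector to the given one, and `K = R* M
  -- R` is the form in standard coordinates.
  let R : EuclideanSpace ℂ ι →L[ℂ] H := ∑ i, (EuclideanSpace.proj i : EuclideanSpace ℂ ι →L[ℂ] ℂ).smulRight ((√(p i) : ℂ) • e i)
  have hR : ∀ x : EuclideanSpace ℂ ι, R x = ∑ i, (x i * (√(p i) : ℂ)) • e i := fun x => by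
    simp only [R, _root_.sum_apply, ContinuousLinearMap.smulRight_apply, smul_smul]
    rfl
  have hRb : ∀ i, R (b i) = (√(p i) : ℂ) • e i := fun i => by
    rw [hR]
    simp [b, ite_smul]
  have hRnorm : ∀ x : EuclideanSpace ℂ ι, ‖R x‖ ^ 2 ≤ P * ‖x‖ ^ 2 := fun x => by
    have h1 := he.orthogonalFamily.norm_sum (fun i => x i * (√(p i) : ℂ)) Finset.univ
    simp only [LinearIsometry.toSpanSingleton_apply] at h1
    rw [hR, h1, EuclideanSpace.norm_sq_eq, Finset.mul_sum]
    refine Finset.sum_le_sum fun i _ => ?_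
    rw [norm_mul, mul_pow, Complex.norm_real, Real.norm_eq_abs, sq_abs,
      Real.sq_sqrt (p i).coe_nonneg, mul_comm]
    gcongr
    exact hP i
  have hMle : ∀ x : H, ‖M x‖ ≤ N * ‖x‖ := fun x =>
    (M.le_opNorm x).trans (by gcongr)
  let K : EuclideanSpace ℂ ι →ₗ[ℂ] EuclideanSpace ℂ ι := ((ContinuousLinearMap.adjoint R) ∘L M ∘L R : EuclideanSpace ℂ ι →L[ℂ] EuclideanSpace ℂ ι)
  have hKin : ∀ x y : EuclideanSpace ℂ ι, ⟪x, K y⟫_ℂ = ⟪R x, M (R y)⟫_ℂ := fun x y =>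
    ContinuousLinearMap.adjoint_inner_right R x (M (R y))
  have hK : K.IsSymmetric := fun x y => by
    rw [← inner_conj_symm, hKin, hKin, inner_conj_symm]
    exact hM _ _
  let n := Module.finrank ℂ (EuclideanSpace ℂ ι)
  let d : Fin n → ℝ := hK.eigenvalues rfl
  let u : OrthonormalBasis (Fin n) ℂ (EuclideanSpace ℂ ι) := hK.eigenvectorBasis rfl
  have hKu : ∀ j, K (u j) = (d j : ℂ) • u j := hK.apply_eigenvectorBasis rfl
  have hdM : ∀ j k, ⟪R (u j), M (R (u k))⟫_ℂ = if j = k then (d k : ℂ) else 0 := fun j k => by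
    rw [← hKin, hKu, inner_smul_right, orthonormal_iff_ite.mp u.orthonormal]
    simp
  have hdle : ∀ j, |d j| ≤ P * N := fun j => by
    have h1 : ‖⟪R (u j), M (R (u j))⟫_ℂ‖ = |d j| := by
      rw [hdM, if_pos rfl, Complex.norm_real, Real.norm_eq_abs]
    rw [← h1]
    refine (norm_inner_le_norm _ _).trans ?_
    have h2 := hRnorm (u j)
    rw [u.orthonormal.1] at h2
    have h3 := mul_le_mul_of_nonneg_left (hMle (R (u j))) (norm_nonneg (R (u j)))
    nlinarith [mul_le_mul_of_nonneg_right h2 hN0]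
  have hsum1 : ∑ j, d j = ∑ i, (p i : ℝ) * (⟪e i, M (e i)⟫_ℂ).re := by
    have h1 := (LinearMap.trace_eq_sum_inner K u).symm.trans (LinearMap.trace_eq_sum_inner K b)
    simp only [hKin, hdM, if_true, hRb, map_smul, inner_smul_left, inner_smul_right] at h1
    have h2 := congrArg Complex.re h1
    rw [Complex.re_sum, Complex.re_sum] at h2
    simp only [Complex.ofReal_re] at h2
    rw [h2]
    refine Finset.sum_congr rfl fun i _ => ?_
    rw [Complex.conj_ofReal, ← mul_assoc, ← Complex.ofReal_mul, Complex.re_ofReal_mul,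
      Real.mul_self_sqrt (p i).coe_nonneg]
  -- The left side is `tr K² = ∑ ‖K b_i‖²`. From `‖K b_i‖² = ⟨R K b_i, M R b_i⟩ ≤ √P ‖K b_i‖ · N
  -- √p_i` each term is at most `p_i P N²`.
  have hsum2 : ∑ j, d j ^ 2 ≤ P * N ^ 2 := by
    have h1 := (LinearMap.trace_eq_sum_inner (K ∘ₗ K) u).symm.trans
      (LinearMap.trace_eq_sum_inner (K ∘ₗ K) b)
    have h2 : ∀ x, (⟪x, (K ∘ₗ K) x⟫_ℂ).re = ‖K x‖ ^ 2 := fun x => by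
      rw [LinearMap.comp_apply, ← hK]
      exact (norm_sq_eq_re_inner (𝕜 := ℂ) _).symm
    have h3 := congrArg Complex.re h1
    rw [Complex.re_sum, Complex.re_sum] at h3
    simp only [h2, hKu, norm_smul, u.orthonormal.1, mul_one, Complex.norm_real, Real.norm_eq_abs,
      sq_abs] at h3
    rw [h3]
    have h4 : ∀ i, ‖K (b i)‖ ^ 2 ≤ p i * (P * N ^ 2) := fun i => by
      have h5 : ‖M (R (b i))‖ ^ 2 ≤ N ^ 2 * p i := by
        have h7 := hMle (R (b i))
        rw [hRb, norm_smul, he.1, mul_one, Complex.norm_real, Real.norm_eq_abs,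
          abs_of_nonneg (Real.sqrt_nonneg _), ← hRb] at h7
        calc _ ≤ (N * √(p i)) ^ 2 := by gcongr
          _ = _ := by rw [mul_pow, Real.sq_sqrt (p i).coe_nonneg]
      have h6 : ‖K (b i)‖ ^ 2 ≤ ‖R (K (b i))‖ * ‖M (R (b i))‖ := by
        rw [norm_sq_eq_re_inner (𝕜 := ℂ), hKin]
        exact (Complex.re_le_norm _).trans (norm_inner_le_norm _ _)
      have h8 := hRnorm (K (b i))
      have h9 : (‖K (b i)‖ ^ 2) ^ 2 ≤ (P * ‖K (b i)‖ ^ 2) * (N ^ 2 * p i) :=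
        calc _ ≤ (‖R (K (b i))‖ * ‖M (R (b i))‖) ^ 2 := by gcongr
          _ = ‖R (K (b i))‖ ^ 2 * ‖M (R (b i))‖ ^ 2 := by ring
          _ ≤ _ := by gcongr
      rcases (sq_nonneg ‖K (b i)‖).eq_or_lt with h0 | h0
      · rw [← h0]; positivity
      · refine le_of_mul_le_mul_right ?_ h0
        linarith
    calc _ ≤ ∑ i, (p i : ℝ) * (P * N ^ 2) := Finset.sum_le_sum fun i _ => h4 i
      _ ≤ 1 * (P * N ^ 2) := by rw [← Finset.sum_mul]; gcongr
      _ = _ := one_mul _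
  -- Both covariances equal `‖R* t‖²`, expanded by Parseval in the bases `b` and `u`.
  have hlaw := map_sum_complexGaussian_eq p (fun _ : Fin n => 1) e (fun j => R (u j)) fun t => by
    have h1 : ∀ x : EuclideanSpace ℂ ι, ‖⟪R x, t⟫_ℂ‖ = ‖⟪x, R.adjoint t⟫_ℂ‖ := fun x => by
      rw [ContinuousLinearMap.adjoint_inner_right]
    simp only [NNReal.coe_one, one_mul, h1]
    rw [u.sum_sq_norm_inner_right, ← b.sum_sq_norm_inner_right]
    refine Finset.sum_congr rfl fun i _ => ?_
    rw [← h1, hRb, inner_smul_left, norm_mul, mul_pow, RCLike.norm_conj, Complex.norm_real,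
      Real.norm_eq_abs, sq_abs, Real.sq_sqrt (p i).coe_nonneg]
  have hmeas : Measurable fun x : H => ENNReal.ofReal (Real.exp (l * (⟪x, M x⟫_ℂ).re)) :=
    Measurable.ennreal_ofReal (Continuous.measurable (by fun_prop))
  rw [← lintegral_map (f := fun x : H => ENNReal.ofReal (Real.exp (l * (⟪x, M x⟫_ℂ).re)))
    (g := fun z : ι → ℂ => ∑ i, z i • e i) hmeas (by fun_prop), hlaw,
    lintegral_map hmeas (by fun_prop)]
  have hq : ∀ z : Fin n → ℂ, l * (⟪∑ j, z j • R (u j), M (∑ j, z j • R (u j))⟫_ℂ).re =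
      ∑ j, (l * d j) * ‖z j‖ ^ 2 := fun z => by
    simp only [map_sum, map_smul, sum_inner, inner_sum, inner_smul_left, inner_smul_right, hdM]
    rw [Complex.re_sum, Finset.mul_sum]
    refine Finset.sum_congr rfl fun j _ => ?_
    have h1 : z j * ((starRingEnd ℂ) (z j) * (d j : ℂ)) = ((‖z j‖ ^ 2 * d j : ℝ) : ℂ) := by
      rw [← mul_assoc, Complex.mul_conj, Complex.normSq_eq_norm_sq, Complex.ofReal_mul]
    simp only [mul_ite, mul_zero, Finset.sum_ite_eq', Finset.mem_univ, if_true, h1,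
      Complex.ofReal_re]
    ring
  simp_rw [hq]
  refine (lintegral_exp_sum_complexGaussian_le fun j => ?_).trans (ENNReal.ofReal_le_ofReal
    (Real.exp_le_exp.mpr ?_))
  · rw [abs_mul, abs_of_nonneg hl]
    exact (mul_le_mul_of_nonneg_left (hdle j) hl).trans hlPN
  · rw [Finset.sum_add_distrib, ← Finset.mul_sum, hsum1]
    simp_rw [mul_pow]
    rw [← Finset.mul_sum]
    gcongr

end QuadraticForm

/-! ### Tail bounds for `G(ρ)`, the adjusted measure and `GAP(ρ)` -/

section Concentration

variable {H : Type u} [NormedAddCommGroup H] [InnerProductSpace ℂ H] [MeasurableSpace H]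
  [BorelSpace H]

theorem measurable_ofReal_exp_quadratic (M : H →L[ℂ] H) (l : ℝ) :
    Measurable fun x : H => ENNReal.ofReal (Real.exp (l * (⟪x, M x⟫_ℂ).re)) :=
  Measurable.ennreal_ofReal (Continuous.measurable (by fun_prop))

variable [CompleteSpace H] [TopologicalSpace.SeparableSpace H] {ρ : H →L[ℂ] H}

/-- Fatou's lemma applied to finite partial sums of the Gaussian series; only an upper bound is
needed, so no domination is required. -/
theorem EigenONB.lintegral_exp_symmetric_le (E : EigenONB ρ) (hρ : IsDensityMatrix ρ)
    {P N l τ : ℝ} (hP : ∀ i, (E.eigenvalue i : ℝ) ≤ P) {M : H →L[ℂ] H}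
    (hM : (M : H →ₗ[ℂ] H).IsSymmetric) (hN : ‖M‖ ≤ N) (hl : 0 ≤ l)
    (hlPN : l * (P * N) ≤ 1 / 2) (hP0 : 0 ≤ P)
    (hτ : HasSum (fun i => (E.eigenvalue i : ℝ) * (⟪E.basis i, M (E.basis i)⟫_ℂ).re) τ) :
    ∫⁻ ψ, ENNReal.ofReal (Real.exp (l * (⟪ψ, M ψ⟫_ℂ).re)) ∂E.gaussian ≤
      ENNReal.ofReal (Real.exp (l * τ + l ^ 2 * (P * N ^ 2))) := by
  have := E.countable_index
  have := UniformSpace.secondCountable_of_separable H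
  have hmeas := measurable_ofReal_exp_quadratic M l
  have hcont : Continuous fun x : H => ENNReal.ofReal (Real.exp (l * (⟪x, M x⟫_ℂ).re)) :=
    ENNReal.continuous_ofReal.comp (by fun_prop)
  rw [EigenONB.gaussian, lintegral_map' hmeas.aemeasurable (E.aemeasurable_tsum hρ)]
  -- Fatou's lemma needs a sequence, so the net of finite subsets is replaced by a sequence tending
  -- to `atTop`, available because the index set is countable.
  obtain ⟨s, hs⟩ := Filter.exists_seq_tendsto (Filter.atTop : Filter (Finset E.index))
  have hfin : ∀ t : Finset E.index,
      ∫⁻ z, ENNReal.ofReal (Real.exp (l * (⟪∑ i ∈ t, z i • E.basis i,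
        M (∑ i ∈ t, z i • E.basis i)⟫_ℂ).re)) ∂E.coeffLaw ≤
      ENNReal.ofReal (Real.exp (l * ∑ i ∈ t, (E.eigenvalue i : ℝ) *
        (⟪E.basis i, M (E.basis i)⟫_ℂ).re + l ^ 2 * (P * N ^ 2))) := fun t => by
    have h1 := lintegral_exp_quadratic_finite_le (e := fun i : t => E.basis i)
      (E.basis.orthonormal.comp _ Subtype.val_injective) (p := fun i : t => E.eigenvalue i)
      (fun i => hP i) (by
        rw [Finset.sum_coe_sort t (fun i => (E.eigenvalue i : ℝ))]
        exact sum_le_hasSum t (fun i _ => (E.eigenvalue i).coe_nonneg) (E.hasSum_eigenvalue hρ))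
      hM hN hl hlPN hP0
    rw [Finset.sum_coe_sort t (fun i => (E.eigenvalue i : ℝ) *
      (⟪E.basis i, M (E.basis i)⟫_ℂ).re)] at h1
    refine le_trans (le_of_eq ?_) h1
    have h2 := Measure.infinitePi_map_restrict (μ := fun i => complexGaussian (E.eigenvalue i))
      (I := t)
    rw [← h2, lintegral_map (f := fun z : t → ℂ => ENNReal.ofReal (Real.exp (l *
      (⟪∑ i, z i • E.basis i, M (∑ i, z i • E.basis i)⟫_ℂ).re)))
      (hmeas.comp (g := fun x : H => ENNReal.ofReal (Real.exp (l * (⟪x, M x⟫_ℂ).re))) (by fun_prop))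
      (by fun_prop)]
    refine lintegral_congr fun z => ?_
    simp only [Finset.restrict]
    rw [Finset.sum_coe_sort t (fun i => z i • E.basis i)]
  calc _ = ∫⁻ z, Filter.liminf (fun n => ENNReal.ofReal (Real.exp (l *
          (⟪∑ i ∈ s n, z i • E.basis i, M (∑ i ∈ s n, z i • E.basis i)⟫_ℂ).re))) Filter.atTop
          ∂E.coeffLaw := by
        refine lintegral_congr_ae ?_
        filter_upwards [E.ae_summable hρ] with z hz
        exact (((hcont.tendsto _).comp (hz.hasSum.comp hs)).liminf_eq).symm
    _ ≤ Filter.liminf (fun n => ∫⁻ z, ENNReal.ofReal (Real.exp (l *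
          (⟪∑ i ∈ s n, z i • E.basis i, M (∑ i ∈ s n, z i • E.basis i)⟫_ℂ).re)) ∂E.coeffLaw)
          Filter.atTop :=
        lintegral_liminf_le fun n => hmeas.comp (by fun_prop)
    _ ≤ Filter.liminf (fun n => ENNReal.ofReal (Real.exp (l * ∑ i ∈ s n, (E.eigenvalue i : ℝ) *
          (⟪E.basis i, M (E.basis i)⟫_ℂ).re + l ^ 2 * (P * N ^ 2)))) Filter.atTop :=
        Filter.liminf_le_liminf (Filter.Eventually.of_forall fun n => hfin (s n))
    _ = _ := by
        have h3 : Continuous fun x : ℝ =>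
            ENNReal.ofReal (Real.exp (l * x + l ^ 2 * (P * N ^ 2))) :=
          ENNReal.continuous_ofReal.comp (by fun_prop)
        exact ((h3.tendsto τ).comp (hτ.comp hs)).liminf_eq

/-- The exponential moments of a quadratic form under the Gaussian measure `G(ρ)`. -/
theorem EigenONB.lintegral_exp_quadratic_le (E : EigenONB ρ) (hρ : IsDensityMatrix ρ)
    {P N l τ : ℝ} (hP : ∀ i, (E.eigenvalue i : ℝ) ≤ P) {M : H →L[ℂ] H} (hN : ‖M‖ ≤ N)
    (hl : 0 ≤ l) (hlPN : l * (P * N) ≤ 1 / 2) (hP0 : 0 ≤ P)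
    (hτ : HasSum (fun i => (E.eigenvalue i : ℝ) * (⟪E.basis i, M (E.basis i)⟫_ℂ).re) τ) :
    ∫⁻ ψ, ENNReal.ofReal (Real.exp (l * (⟪ψ, M ψ⟫_ℂ).re)) ∂E.gaussian ≤
      ENNReal.ofReal (Real.exp (l * τ + l ^ 2 * (P * N ^ 2))) := by
  -- Only the self-adjoint part of `M` contributes to the real part of the form, and its norm is at
  -- most `‖M‖`.
  let S : H →L[ℂ] H := (1 / 2 : ℂ) • (M + M.adjoint)
  have hS : ∀ x, (⟪x, S x⟫_ℂ).re = (⟪x, M x⟫_ℂ).re := fun x => by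
    have h1 : ⟪x, M.adjoint x⟫_ℂ = (starRingEnd ℂ) ⟪x, M x⟫_ℂ := by
      rw [ContinuousLinearMap.adjoint_inner_right, inner_conj_symm]
    have h2 : ⟪x, S x⟫_ℂ = (1 / 2 : ℂ) * (⟪x, M x⟫_ℂ + (starRingEnd ℂ) ⟪x, M x⟫_ℂ) := by
      rw [← h1, ← inner_add_right, ← inner_smul_right]
      rfl
    rw [h2, Complex.add_conj]
    simp
  have hsymm : (S : H →ₗ[ℂ] H).IsSymmetric := by
    refine IsSelfAdjoint.isSymmetric ?_
    rw [ContinuousLinearMap.isSelfAdjoint_iff']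
    simp only [S, map_smulₛₗ, map_add, ContinuousLinearMap.adjoint_adjoint]
    rw [add_comm]
    simp [map_ofNat]
  have hSN : ‖S‖ ≤ N := by
    have h1 := norm_add_le M M.adjoint
    rw [LinearIsometryEquiv.norm_map] at h1
    rw [norm_smul]
    norm_num
    linarith
  have := E.lintegral_exp_symmetric_le hρ hP hsymm hSN hl hlPN hP0 (τ := τ) (by simpa only [hS])
  simpa only [hS] using this

/-- The exponential moment bound with `M = 1` and `l = 1 / 2` gives `E exp (‖ψ‖² / 2) ≤ exp (3 /
4)`, and an exponential dominates the square of `‖ψ‖²`. -/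
theorem EigenONB.lintegral_norm_pow_four_le (E : EigenONB ρ) (hρ : IsDensityMatrix ρ) :
    ∫⁻ ψ, ENNReal.ofReal (‖ψ‖ ^ 4) ∂E.gaussian ≤ ENNReal.ofReal 5 := by
  have hself : ∀ ψ : H, (⟪ψ, (1 : H →L[ℂ] H) ψ⟫_ℂ).re = ‖ψ‖ ^ 2 := fun ψ =>
    (norm_sq_eq_re_inner (𝕜 := ℂ) ψ).symm
  have h1 := E.lintegral_exp_quadratic_le hρ (P := 1) (N := 1) (l := 1 / 2) (τ := 1) (M := 1)
    (fun i => le_hasSum (E.hasSum_eigenvalue hρ) i fun j _ => (E.eigenvalue j).coe_nonneg)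
    ContinuousLinearMap.norm_id_le (by norm_num) (by norm_num) zero_le_one (by
      simp only [hself, E.basis.orthonormal.1]
      simpa using E.hasSum_eigenvalue hρ)
  simp only [hself] at h1
  -- The constant is optimal: `x² exp (-x / 2)` is largest at `x = 4`.
  have h2 : ∀ x : ℝ, 0 ≤ x → x ^ 2 ≤ 16 * Real.exp (-2) * Real.exp (1 / 2 * x) := fun x hx => by
    have h3 := Real.add_one_le_exp (x / 4 - 1)
    have h4 : (x / 4) ^ 2 ≤ Real.exp (x / 4 - 1) ^ 2 := by gcongr; linarith
    rw [← Real.exp_nat_mul] at h4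
    rw [mul_assoc, ← Real.exp_add]
    have h5 : ((2 : ℕ) : ℝ) * (x / 4 - 1) = -2 + 1 / 2 * x := by push_cast; ring
    rw [h5] at h4
    linarith
  calc _ ≤ ∫⁻ ψ, ENNReal.ofReal (16 * Real.exp (-2)) *
        ENNReal.ofReal (Real.exp (1 / 2 * ‖ψ‖ ^ 2)) ∂E.gaussian := by
        refine lintegral_mono fun ψ => ?_
        rw [← ENNReal.ofReal_mul (by positivity)]
        refine ENNReal.ofReal_le_ofReal ((le_of_eq ?_).trans (h2 _ (sq_nonneg _)))
        ring
    _ ≤ ENNReal.ofReal (16 * Real.exp (-2)) *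
        ENNReal.ofReal (Real.exp (1 / 2 * 1 + (1 / 2) ^ 2 * (1 * 1 ^ 2))) := by
        rw [lintegral_const_mul' _ _ ENNReal.ofReal_ne_top]
        gcongr
    _ ≤ _ := by
        rw [← ENNReal.ofReal_mul (by positivity), mul_assoc, ← Real.exp_add]
        refine ENNReal.ofReal_le_ofReal ?_
        -- What remains is `16 exp (-5 / 4) ≤ 5`.
        have h6 := Real.quadratic_le_exp_of_nonneg (x := 5 / 8) (by norm_num)
        have h7 : Real.exp (5 / 8) ^ 2 * Real.exp (-2 + (1 / 2 * 1 + (1 / 2) ^ 2 * (1 * 1 ^ 2))) = 1 := by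
          rw [← Real.exp_nat_mul, ← Real.exp_add]
          norm_num
        have h8 : (16 / 5 : ℝ) ≤ Real.exp (5 / 8) ^ 2 := by nlinarith
        nlinarith [mul_le_mul_of_nonneg_right h8
          (Real.exp_pos (-2 + (1 / 2 * 1 + (1 / 2) ^ 2 * (1 * 1 ^ 2)))).le]

/-- Tail bound for a quadratic form of negative mean under the adjusted measure. -/
theorem EigenONB.adjust_quadratic_pos_le (E : EigenONB ρ) (hρ : IsDensityMatrix ρ)
    {P N δ : ℝ} (hP : ∀ i, (E.eigenvalue i : ℝ) ≤ P) (hP0 : 0 < P) {M : H →L[ℂ] H}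
    (hN : ‖M‖ ≤ N) (hN0 : 0 < N) (hδ : 0 ≤ δ) (hδN : δ ≤ N)
    (hτ : HasSum (fun i => (E.eigenvalue i : ℝ) * (⟪E.basis i, M (E.basis i)⟫_ℂ).re) (-δ)) :
    adjust E.gaussian {ψ | 0 < (⟪ψ, M ψ⟫_ℂ).re} ≤
      ENNReal.ofReal (3 * Real.exp (-(δ ^ 2 / (8 * P * N ^ 2)))) := by
  set x := δ ^ 2 / (8 * P * N ^ 2) with hx
  -- The minimiser of `-l δ + l² P N²`, with minimum `-2x`. It is admissible since `l P N = δ / (2N)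
  -- ≤ 1 / 2`.
  let l := δ / (2 * P * N ^ 2)
  have hl : 0 ≤ l := by positivity
  have h1 := E.lintegral_exp_quadratic_le hρ hP hN hl (by
    have : l * (P * N) = δ / N * (1 / 2) := by simp only [l]; field_simp
    rw [this]
    have := (div_le_one hN0).mpr hδN
    linarith) hP0.le hτ
  have h2 : l * -δ + l ^ 2 * (P * N ^ 2) = -(2 * x) := by
    simp only [l, hx]
    field_simp
    ring
  rw [h2] at h1
  have hmeas : MeasurableSet {ψ : H | 0 < (⟪ψ, M ψ⟫_ℂ).re} :=
    (isOpen_lt continuous_const (by fun_prop)).measurableSet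
  rw [adjust, withDensity_apply _ hmeas, ← lintegral_indicator hmeas]
  -- On the event, `‖ψ‖² ≤ (e^{-x} ‖ψ‖⁴ + e^x) / 2`, and the last term may be multiplied by the
  -- exponential, which is at least 1 there. After integration the parts are at most `5/2 · e^{-x}`
  -- and `1/2 · e^x e^{-2x}`, whence the factor 3.
  have hpt : ∀ ψ : H, {ψ : H | 0 < (⟪ψ, M ψ⟫_ℂ).re}.indicator (fun ψ => ‖ψ‖ₑ ^ 2) ψ ≤
      ENNReal.ofReal (Real.exp (-x) / 2) * ENNReal.ofReal (‖ψ‖ ^ 4) +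
      ENNReal.ofReal (Real.exp x / 2) *
        ENNReal.ofReal (Real.exp (l * (⟪ψ, M ψ⟫_ℂ).re)) := fun ψ => by
    by_cases hψ : ψ ∈ {ψ : H | 0 < (⟪ψ, M ψ⟫_ℂ).re}
    swap
    · rw [Set.indicator_of_notMem hψ]
      exact zero_le
    rw [Set.indicator_of_mem hψ]
    replace hψ : 0 < (⟪ψ, M ψ⟫_ℂ).re := hψ
    rw [← ofReal_norm, ← ENNReal.ofReal_pow (norm_nonneg _),
      ← ENNReal.ofReal_mul (by positivity), ← ENNReal.ofReal_mul (by positivity),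
      ← ENNReal.ofReal_add (by positivity) (by positivity)]
    refine ENNReal.ofReal_le_ofReal ?_
    have h3 : 1 ≤ Real.exp (l * (⟪ψ, M ψ⟫_ℂ).re) := Real.one_le_exp (by positivity)
    have h4 : Real.exp (-x) * Real.exp x = 1 := by rw [← Real.exp_add]; simp
    have h5 : Real.exp x / 2 ≤ Real.exp x / 2 * Real.exp (l * (⟪ψ, M ψ⟫_ℂ).re) :=
      le_mul_of_one_le_right (by positivity) h3
    have h6 : 0 ≤ Real.exp x * (Real.exp (-x) * ‖ψ‖ ^ 2 - 1) ^ 2 := by positivity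
    have h7 : Real.exp x * (Real.exp (-x) * ‖ψ‖ ^ 2 - 1) ^ 2 =
        (Real.exp (-x) * Real.exp x) * (Real.exp (-x) * ‖ψ‖ ^ 4) -
        2 * (Real.exp (-x) * Real.exp x) * ‖ψ‖ ^ 2 + Real.exp x := by ring
    rw [h7, h4] at h6
    linarith
  refine (lintegral_mono hpt).trans ?_
  rw [lintegral_add_left (by fun_prop), lintegral_const_mul' _ _ ENNReal.ofReal_ne_top,
    lintegral_const_mul' _ _ ENNReal.ofReal_ne_top]
  refine (add_le_add (mul_le_mul' le_rfl (E.lintegral_norm_pow_four_le hρ))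
    (mul_le_mul' le_rfl h1)).trans (le_of_eq ?_)
  rw [← ENNReal.ofReal_mul (by positivity), ← ENNReal.ofReal_mul (by positivity),
    ← ENNReal.ofReal_add (by positivity) (by positivity)]
  congr 1
  have h8 : Real.exp x * Real.exp (-(2 * x)) = Real.exp (-x) := by
    rw [← Real.exp_add]; ring_nf
  rw [div_mul_eq_mul_div _ _ (Real.exp (-(2 * x))), h8]
  ring

theorem GAP_le_adjust (hρ : IsDensityMatrix ρ) (E : EigenONB ρ) (B : H →L[ℂ] H) (t : ℂ) (ε : ℝ) :
    GAP ρ hρ {ψ : Metric.sphere (0 : H) 1 | ε < ‖⟪(ψ : H), B (ψ : H)⟫_ℂ - t‖} ≤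
      adjust E.gaussian {ψ | ψ ≠ 0 ∧ ε * ‖ψ‖ ^ 2 < ‖⟪ψ, B ψ⟫_ℂ - t * (‖ψ‖ ^ 2 : ℝ)‖} := by
  have hm : Measurable fun ψ : H => (‖ψ‖⁻¹ : ℝ) • ψ := by
    have := UniformSpace.secondCountable_of_separable H
    fun_prop
  rw [GAP_eq hρ E, projectToSphere, comap_subtype_coe_apply Metric.isClosed_sphere.measurableSet]
  have hA : MeasurableSet (Metric.sphere (0 : H) 1 ∩ {φ : H | ε < ‖⟪φ, B φ⟫_ℂ - t‖}) :=
    Metric.isClosed_sphere.measurableSet.inter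
      (isOpen_lt continuous_const (by fun_prop)).measurableSet
  refine (measure_mono (t := Metric.sphere (0 : H) 1 ∩ {φ : H | ε < ‖⟪φ, B φ⟫_ℂ - t‖}) ?_).trans ?_
  · rintro _ ⟨ψ, hψ, rfl⟩
    exact ⟨ψ.2, hψ⟩
  rw [Measure.map_apply hm hA]
  refine measure_mono fun ψ hψ => ?_
  obtain ⟨h1, h2⟩ := hψ
  have h0 : ψ ≠ 0 := fun h => by simp [h] at h1
  refine ⟨h0, ?_⟩
  have hpos : 0 < ‖ψ‖ := norm_pos_iff.mpr h0
  have h3 : ⟪(‖ψ‖⁻¹ : ℝ) • ψ, B ((‖ψ‖⁻¹ : ℝ) • ψ)⟫_ℂ - t =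
      ((‖ψ‖ ^ 2 : ℝ) : ℂ)⁻¹ * (⟪ψ, B ψ⟫_ℂ - t * (‖ψ‖ ^ 2 : ℝ)) := by
    rw [← Complex.coe_smul, map_smul, inner_smul_left, inner_smul_right, Complex.conj_ofReal]
    have : (‖ψ‖ : ℂ) ≠ 0 := Complex.ofReal_ne_zero.mpr hpos.ne'
    push_cast
    field_simp
  rw [Set.mem_ofPred_eq, h3, norm_mul, norm_inv, Complex.norm_real, Real.norm_eq_abs,
    abs_of_pos (by positivity), lt_inv_mul_iff₀ (by positivity)] at h2
  linarith

theorem exists_half_norm_le_re_mul (z : ℂ) :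
    ∃ c ∈ ({1, -1, Complex.I, -Complex.I} : Finset ℂ), ‖z‖ / 2 ≤ (c * z).re := by
  have h := Complex.norm_le_abs_re_add_abs_im z
  simp only [Finset.mem_insert, Finset.mem_singleton, exists_eq_or_imp, exists_eq_left]
  simp only [one_mul, neg_mul, Complex.neg_re, Complex.I_mul_re, neg_neg]
  by_contra! hc
  rcases abs_cases z.re with h1 | h1 <;> rcases abs_cases z.im with h2 | h2 <;> linarith

/-- The tail bound for a form of negative mean is used with `δ = ε / 2` and `N = 3‖B‖`, so that `8
N² / δ²` becomes `288 ‖B‖² / ε²`. Four directions with prefactor 3 give 12. -/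
theorem GAP_concentration (hρ : IsDensityMatrix ρ) {B : H →L[ℂ] H} {t : ℂ}
    (ht : HasTrace (ρ ∘L B) t) {ε : ℝ} (hε : 0 ≤ ε) :
    GAP ρ hρ {ψ : Metric.sphere (0 : H) 1 | ε < ‖⟪(ψ : H), B (ψ : H)⟫_ℂ - t‖} ≤
      ENNReal.ofReal (12 * Real.exp (-(ε ^ 2 / (288 * (‖B‖ ^ 2 * ‖ρ‖))))) := by
  obtain ⟨E⟩ := hρ.nonempty_eigenONB
  have htB := norm_trace_le hρ ht
  refine (GAP_le_adjust hρ E B t ε).trans ?_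
  -- For `ε ≥ 2‖B‖` the event is empty, since `‖t‖ ≤ ‖B‖`; this also covers `B = 0`. Otherwise `ε /
  -- 2 < ‖B‖`, which bounds the shift in `M` below.
  rcases le_or_gt (2 * ‖B‖) ε with hεB | hεB
  · refine (measure_mono_null ?_ measure_empty).le.trans zero_le
    rintro ψ ⟨-, hψ⟩
    have h1 := norm_sub_le ⟪ψ, B ψ⟫_ℂ (t * (‖ψ‖ ^ 2 : ℝ))
    rw [norm_mul, Complex.norm_real, Real.norm_eq_abs, abs_of_nonneg (sq_nonneg ‖ψ‖)] at h1
    have h2 := norm_inner_apply_self_le B ψ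
    have h3 := mul_le_mul_of_nonneg_right htB (sq_nonneg ‖ψ‖)
    have h4 := mul_le_mul_of_nonneg_right hεB (sq_nonneg ‖ψ‖)
    linarith
  have hB : 0 < ‖B‖ := by linarith
  let M : ℂ → H →L[ℂ] H := fun c => c • (B - t • 1) - ((ε / 2 : ℝ) : ℂ) • 1
  have hMin : ∀ c ψ, (⟪ψ, M c ψ⟫_ℂ).re =
      (c * (⟪ψ, B ψ⟫_ℂ - t * (‖ψ‖ ^ 2 : ℝ))).re - ε / 2 * ‖ψ‖ ^ 2 := fun c ψ => by
    have h1 : ⟪ψ, M c ψ⟫_ℂ = c * (⟪ψ, B ψ⟫_ℂ - t * (‖ψ‖ ^ 2 : ℝ)) -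
        ((ε / 2 * ‖ψ‖ ^ 2 : ℝ) : ℂ) := by
      simp only [M, _root_.sub_apply, _root_.smul_apply, one_apply_eq_self, inner_sub_right,
        inner_smul_right, inner_self_eq_norm_sq_to_K]
      push_cast
      rfl
    rw [h1, Complex.sub_re, Complex.ofReal_re]
  have hsub : {ψ : H | ψ ≠ 0 ∧ ε * ‖ψ‖ ^ 2 < ‖⟪ψ, B ψ⟫_ℂ - t * (‖ψ‖ ^ 2 : ℝ)‖} ⊆
      ⋃ c ∈ ({1, -1, Complex.I, -Complex.I} : Finset ℂ), {ψ | 0 < (⟪ψ, M c ψ⟫_ℂ).re} := by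
    rintro ψ ⟨-, hψ⟩
    obtain ⟨c, hc, h1⟩ := exists_half_norm_le_re_mul (⟪ψ, B ψ⟫_ℂ - t * (‖ψ‖ ^ 2 : ℝ))
    refine Set.mem_biUnion hc ?_
    rw [Set.mem_ofPred_eq, hMin]
    linarith
  have hbound : ∀ c ∈ ({1, -1, Complex.I, -Complex.I} : Finset ℂ),
      adjust E.gaussian {ψ | 0 < (⟪ψ, M c ψ⟫_ℂ).re} ≤
        ENNReal.ofReal (3 * Real.exp (-(ε ^ 2 / (288 * (‖B‖ ^ 2 * ‖ρ‖))))) := fun c hc => by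
    have hc1 : ‖c‖ = 1 := by
      simp only [Finset.mem_insert, Finset.mem_singleton] at hc
      rcases hc with rfl | rfl | rfl | rfl <;> simp
    have h1 : ‖(1 : H →L[ℂ] H)‖ ≤ 1 := ContinuousLinearMap.norm_id_le
    have hMN : ‖M c‖ ≤ 3 * ‖B‖ := by
      have h2 : ‖c • (B - t • (1 : H →L[ℂ] H))‖ ≤ ‖B‖ + ‖B‖ * 1 := by
        rw [norm_smul, hc1, one_mul]
        refine (norm_sub_le _ _).trans ?_
        rw [norm_smul]
        gcongr
      have h3 : ‖((ε / 2 : ℝ) : ℂ) • (1 : H →L[ℂ] H)‖ ≤ ‖B‖ * 1 := by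
        rw [norm_smul, Complex.norm_real, Real.norm_eq_abs, abs_of_nonneg (by positivity)]
        gcongr
        linarith
      linarith [norm_sub_le (c • (B - t • (1 : H →L[ℂ] H))) (((ε / 2 : ℝ) : ℂ) • 1)]
    have hτ : HasSum (fun i => (E.eigenvalue i : ℝ) *
        (⟪E.basis i, M c (E.basis i)⟫_ℂ).re) (-(ε / 2)) := by
      have h2 := Complex.hasSum_re (((E.hasSum_trace hρ ht).sub
        ((Complex.hasSum_ofReal.mpr (E.hasSum_eigenvalue hρ)).mul_left t)).mul_left c)
      have h3 := h2.sub ((E.hasSum_eigenvalue hρ).mul_right (ε / 2))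
      have h4 : (c * (t - t * ((1 : ℝ) : ℂ))).re - 1 * (ε / 2) = -(ε / 2) := by simp
      rw [h4] at h3
      refine h3.congr_fun fun i => ?_
      have h5 : c * ((E.eigenvalue i : ℂ) * ⟪E.basis i, B (E.basis i)⟫_ℂ -
          t * ((E.eigenvalue i : ℝ) : ℂ)) = ((E.eigenvalue i : ℝ) : ℂ) *
          (c * (⟪E.basis i, B (E.basis i)⟫_ℂ - t * ((1 ^ 2 : ℝ) : ℂ))) := by
        push_cast
        ring
      rw [hMin, E.basis.orthonormal.1, h5, Complex.re_ofReal_mul]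
      ring
    refine (E.adjust_quadratic_pos_le hρ E.eigenvalue_le_opNorm hρ.norm_pos hMN (by positivity)
      (by positivity) (by linarith) hτ).trans (le_of_eq ?_)
    congr 4
    rw [div_pow, div_div]
    congr 1
    ring
  refine (measure_mono hsub).trans ((measure_biUnion_finset_le _ _).trans ?_)
  refine (Finset.sum_le_card_nsmul _ _ _ hbound).trans ?_
  rw [nsmul_eq_mul, ← ENNReal.ofReal_natCast, ← ENNReal.ofReal_mul (by positivity)]
  refine ENNReal.ofReal_le_ofReal ?_
  have h4 : ((({1, -1, Complex.I, -Complex.I} : Finset ℂ).card : ℕ) : ℝ) ≤ 4 := by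
    exact_mod_cast Finset.card_le_four
  nlinarith [mul_le_mul_of_nonneg_right h4
    (by positivity : 0 ≤ 3 * Real.exp (-(ε ^ 2 / (288 * (‖B‖ ^ 2 * ‖ρ‖)))))]

end Concentration

end GapMeasure

theorem corollary1 {H : Type*} [NormedAddCommGroup H] [InnerProductSpace ℂ H] [CompleteSpace H]
    [TopologicalSpace.SeparableSpace H] [MeasurableSpace H] [BorelSpace H]
    (ρ : H →L[ℂ] H) (hρ : GapMeasure.IsDensityMatrix ρ) (B : H →L[ℂ] H)
    (ε : ℝ) (hε : 0 ≤ ε) :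
    GapMeasure.HasTrace (ρ ∘L B) (GapMeasure.trace (ρ ∘L B)) ∧
    GapMeasure.GAP ρ hρ
        {ψ : Metric.sphere (0 : H) 1 |
          ε < ‖⟪(ψ : H), B (ψ : H)⟫_ℂ - GapMeasure.trace (ρ ∘L B)‖} ≤
      ENNReal.ofReal (12 * Real.exp
        (-((1 / (2304 * Real.pi ^ 2)) * ε ^ 2 / (‖B‖ ^ 2 * ‖ρ‖)))) := by
  obtain ⟨E⟩ := hρ.nonempty_eigenONB
  have ht := E.hasTrace_comp hρ B
  rw [← ht.trace_eq] at ht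
  refine ⟨ht, (GapMeasure.GAP_concentration hρ ht hε).trans (ENNReal.ofReal_le_ofReal ?_)⟩
  -- The stated constant is smaller than the one obtained, by a factor `8π²`.
  have h1 : 1 / (2304 * Real.pi ^ 2) ≤ 1 / 288 := by
    gcongr
    nlinarith [Real.pi_gt_three]
  have h2 : 0 ≤ ε ^ 2 / (‖B‖ ^ 2 * ‖ρ‖) := by positivity
  rw [mul_div_assoc, mul_comm 288, ← div_div, div_eq_mul_one_div _ (288 : ℝ),
    mul_comm _ (1 / 288 : ℝ)]
  gcongr
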